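/- Let $G$ be a finitely presented group. Put $V=H_1(G,\mathbb{C})$ and $b_1(G)=\dim_{\mathbb{C}}V$, and identify the dual space $V^*$ with $H^1(G,\mathbb{C})$. Let $\cup_G\colon V^*\wedge V^*\to H^2(G,\mathbb{C})$ be the cup-product map, and let $K\subseteq V\wedge V$ be the subspace whose orthogonal complement $K^\perp\subseteq V^*\wedge V^*=(V\wedge V)^*$ is $\ker(\cup_G)$. The resonance variety of $G$ is $$\mathcal{R}(G)=\{a\in V^*\mid \exists\, b\in V^* \text{ such that } a\wedge b\neq 0 \text{ and } a\wedge b\in K^\perp\}\cup\{0\}.$$ The deficiency $\mathrm{df}(G)$ is the supremum, over all finite presentations of $G$, of the number of generators minus the number of relators. If $\mathcal{R}(G)=\{0\}$, then $\mathrm{df}(G)\le 3-b_1(G)$. -/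

import Mathlib

noncomputable section

open CategoryTheory

namespace VanishingResonance

section Resonance

variable {V : Type*} [AddCommGroup V] [Module ℂ V]

/-- The decomposable element `a ∧ b` of `V ∧ V`. -/
def wedge (a b : V) : ⋀[ℂ]^2 V := exteriorPower.ιMulti ℂ 2 ![a, b]

/-- For a subspace `K` of `V ∧ V`, the subspace `K^⊥` of `V^* ∧ V^*` consisting of all elements
which vanish on `K`, under the pairing `⟨a ∧ b, v ∧ w⟩ = a(v) b(w) - a(w) b(v)`. -/
def orthogonal (K : Submodule ℂ (⋀[ℂ]^2 V)) : Submodule ℂ (⋀[ℂ]^2 (Module.Dual ℂ V)) :=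
  K.dualAnnihilator.comap (exteriorPower.pairingDual ℂ V 2)

/-- For a subspace `L` of `V^* ∧ V^*`, the subspace of `V ∧ V` orthogonal to `L` under the same
pairing. -/
def coorthogonal (L : Submodule ℂ (⋀[ℂ]^2 (Module.Dual ℂ V))) : Submodule ℂ (⋀[ℂ]^2 V) :=
  (L.map (exteriorPower.pairingDual ℂ V 2)).dualCoannihilator

/-- The resonance variety `R(V, K)`: the origin, together with all `a` in `V^*` for which there is
`b` in `V^*` such that `a ∧ b` is non-zero and lies in `K^⊥`. -/
def resonanceVariety (K : Submodule ℂ (⋀[ℂ]^2 V)) : Set (Module.Dual ℂ V) :=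
  {a | ∃ b : Module.Dual ℂ V, wedge a b ≠ 0 ∧ wedge a b ∈ orthogonal K} ∪ {0}

end Resonance

section Groups

variable (G : Type) [Group G]

/-- The trivial one-dimensional complex representation of `G`. -/
abbrev triv : Rep ℂ G := Rep.trivial ℂ G ℂ

/-- `H_1(G, ℂ)`. -/
abbrev HH1 : Type := groupHomology (triv G) 1

/-- `H^1(G, ℂ)`. -/
abbrev CH1 : Type := groupCohomology (triv G) 1

/-- `H^2(G, ℂ)`. -/
abbrev CH2 : Type := groupCohomology (triv G) 2

/-- The first Betti number `b_1(G) = dim H_1(G, ℂ)`. -/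
def b₁ : ℕ := Module.finrank ℂ (HH1 G)

variable {G}

/-- The class in `H_1(G, ℂ)` of a group element. -/
def homologyClass (g : G) : HH1 G :=
  groupHomology.mkH1OfIsTrivial (triv G) (Additive.ofMul (Abelianization.of g)) (1 : ℂ)

theorem homologyClass_mul (g h : G) :
    homologyClass (g * h) = homologyClass g + homologyClass h := by
  simp only [homologyClass, map_mul, ofMul_mul, map_add, LinearMap.add_apply]

/-- The identification `H_1(G, ℂ)^* = Hom(G, ℂ)`, which sends `φ` to `g ↦ φ([g])`. -/
def dualToHom : Module.Dual ℂ (HH1 G) →ₗ[ℂ] (Additive G →+ ℂ) where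
  toFun φ :=
    { toFun := fun g => φ (homologyClass g.toMul)
      map_zero' := by
        have h := homologyClass_mul (1 : G) 1
        simp only [mul_one, left_eq_add] at h
        simp [h]
      map_add' := fun g h => by simp [homologyClass_mul] }
  map_add' _ _ := rfl
  map_smul' _ _ := rfl

/-- The identification `H_1(G, ℂ)^* = H^1(G, ℂ)`, which sends `φ` to the class of the cocycle
`g ↦ φ([g])`. -/
def dualToH1 : Module.Dual ℂ (HH1 G) →ₗ[ℂ] CH1 G :=
  (groupCohomology.H1IsoOfIsTrivial (triv G)).inv.hom ∘ₗ dualToHom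

/-- The product of two homomorphisms `G → ℂ`, as a `2`-cocycle: `(g, h) ↦ a(g) b(h)`. -/
def cupCocycle (a b : Additive G →+ ℂ) : groupCohomology.cocycles₂ (triv G) :=
  ⟨fun p => a (Additive.ofMul p.1) * b (Additive.ofMul p.2), by
    rw [groupCohomology.mem_cocycles₂_iff]
    intro g h j
    simp only [ofMul_mul, map_add, Representation.trivial_apply]
    ring⟩

/-- The cup product `H^1(G, ℂ) × H^1(G, ℂ) → H^2(G, ℂ)`. -/
def cup : CH1 G →ₗ[ℂ] CH1 G →ₗ[ℂ] CH2 G :=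
  (LinearMap.mk₂ ℂ
    (fun a b : Additive G →+ ℂ => groupCohomology.H2π (triv G) (cupCocycle a b))
    (fun a a' b => by
      rw [← map_add]; congr 1; ext p
      exact add_mul (a _) (a' _) (b _))
    (fun c a b => by
      rw [← map_smul]; congr 1; ext p
      exact mul_assoc c (a _) (b _))
    (fun a b b' => by
      rw [← map_add]; congr 1; ext p
      exact mul_add (a _) (b _) (b' _))
    (fun c a b => by
      rw [← map_smul]; congr 1; ext p
      exact mul_left_comm (a _) c (b _))).compl₁₂
    (groupCohomology.H1IsoOfIsTrivial (triv G)).hom.hom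
    (groupCohomology.H1IsoOfIsTrivial (triv G)).hom.hom

theorem cup_self (x : CH1 G) : cup x x = 0 := by
  set a : Additive G →+ ℂ := (groupCohomology.H1IsoOfIsTrivial (triv G)).hom.hom x with ha
  change groupCohomology.H2π (triv G) (cupCocycle a a) = 0
  rw [groupCohomology.H2π_eq_zero_iff]
  refine ⟨fun g => -(a (Additive.ofMul g)) ^ 2 / 2, ?_⟩
  ext p
  change (-(a (Additive.ofMul p.2)) ^ 2 / 2 : ℂ) - -(a (Additive.ofMul (p.1 * p.2))) ^ 2 / 2
    + -(a (Additive.ofMul p.1)) ^ 2 / 2 = a (Additive.ofMul p.1) * a (Additive.ofMul p.2)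
  rw [ofMul_mul, map_add]
  ring

variable (G)

/-- The cup-product map `∪_G : V^* ∧ V^* → H^2(G, ℂ)`, where `V = H_1(G, ℂ)` and `V^*` is
identified with `H^1(G, ℂ)`. -/
def cupMap : ⋀[ℂ]^2 (Module.Dual ℂ (HH1 G)) →ₗ[ℂ] CH2 G :=
  exteriorPower.alternatingMapLinearEquiv
    { toFun := fun v => cup (dualToH1 (v 0)) (dualToH1 (v 1))
      map_update_add' := @fun inst v i x y => by
        rw [Subsingleton.elim inst (instDecidableEqFin 2)]
        fin_cases i <;> simp
      map_update_smul' := @fun inst v i c x => by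
        rw [Subsingleton.elim inst (instDecidableEqFin 2)]
        fin_cases i <;> simp
      map_eq_zero_of_eq' := fun v i j h hij => by
        have h01 : v 0 = v 1 := by
          fin_cases i <;> fin_cases j <;> simp_all
        rw [h01, cup_self] }

/-- The subspace `K` of `V ∧ V`, `V = H_1(G, ℂ)`, to which the kernel of the cup-product map is
orthogonal. -/
def relationSpace : Submodule ℂ (⋀[ℂ]^2 (HH1 G)) :=
  coorthogonal (LinearMap.ker (cupMap G))

/-- The resonance variety `R(G) = R(V, K)` of a group `G`, a subset of `V^* = H^1(G, ℂ)`. -/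
def groupResonance : Set (Module.Dual ℂ (HH1 G)) := resonanceVariety (relationSpace G)

end Groups

section Deficiency

variable (G : Type*) [Group G]

/-- `G` has a presentation with `m` generators and `q` relators; the relators are counted with
multiplicity. -/
def HasPresentation (m q : ℕ) : Prop :=
  ∃ r : Fin q → FreeGroup (Fin m), Nonempty (PresentedGroup (Set.range r) ≃* G)

/-- The deficiency of `G`: the supremum, over all finite presentations of `G`, of the number of
generators minus the number of relators. The supremum is taken in the extended reals. -/
def deficiency : EReal :=
  ⨆ (m : ℕ) (q : ℕ) (_ : HasPresentation G m q), (((m : ℝ) - (q : ℝ) : ℝ) : EReal)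

end Deficiency

end VanishingResonance

end

/-! Write n = b₁(G) and h = dim H²(G, ℂ). Two inequalities bound m - q for every presentation with m
generators and q relators.

Topological: h + m ≤ q + n (`finrank_CH2_add_le`). Pulled back to the free group, a 2-cocycle
acquires a primitive. The values of the primitive on the relators, modulo those of homomorphisms
from the free group, detect its class, so h ≤ q - rank. The rank is at least m - n, because a
homomorphism killing the relators descends to G.

Geometric: 2n ≤ h + 3 (`two_mul_finrank_le`). Vanishing resonance means that ker ∪_G contains no
nonzero decomposable a ∧ b. For n ≥ 2 the cone of decomposables in ⋀²V* has dimension 2n - 3, and h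
linear equations can cut it down to its vertex only if h ≥ 2n - 3. Algebraically, the vertex prime
has height at least 2n - 3 by an explicit chain of primes, and at most h by Krull's height theorem.

Together, m - q ≤ n - h ≤ 3 - n. -/

noncomputable section

open CategoryTheory

namespace VanishingResonance

/-! ### Linear sections of the cone over the Grassmannian of planes -/

section Pluecker

open MvPolynomial

/-- The ideal of the Plücker relations among the entries of a square matrix. -/
def plueckerIdeal (ι : Type*) : Ideal (MvPolynomial (ι × ι) ℂ) :=
  Ideal.span (Set.range fun x : (ι × ι) × (ι × ι) =>
    X (x.1.1, x.1.2) * X (x.2.1, x.2.2) -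
      (X (x.1.1, x.2.1) * X (x.1.2, x.2.2) - X (x.1.1, x.2.2) * X (x.1.2, x.2.1)))

variable {ι : Type*} {B : Type*} [CommRing B] [Algebra ℂ B]

/-- The algebra map which sends the generic matrix to the matrix of `2 × 2`-minors of `(a, b)`. -/
def minorsHom (a b : ι → B) : MvPolynomial (ι × ι) ℂ →ₐ[ℂ] B :=
  aeval fun p => a p.1 * b p.2 - a p.2 * b p.1

@[simp]
theorem minorsHom_X (a b : ι → B) (i j : ι) :
    minorsHom a b (X (i, j)) = a i * b j - a j * b i := by
  simp [minorsHom]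

theorem plueckerIdeal_le_ker_minorsHom (a b : ι → B) :
    plueckerIdeal ι ≤ RingHom.ker (minorsHom a b) := by
  rw [plueckerIdeal, Ideal.span_le]
  rintro _ ⟨x, rfl⟩
  simp only [SetLike.mem_coe, RingHom.mem_ker, map_sub, map_mul, minorsHom_X]
  ring

/-- A point of the variety of the Plücker relations is a matrix of `2 × 2`-minors. -/
theorem exists_minors_of_pluecker {P : ι → ι → ℂ}
    (h : ∀ i j k l, P i j * P k l = P i k * P j l - P i l * P j k) :
    ∃ a b : ι → ℂ, ∀ k l, P k l = a k * b l - a l * b k := by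
  by_cases h0 : ∀ i j, P i j = 0
  · exact ⟨0, 0, fun k l => by simp [h0]⟩
  · push Not at h0
    obtain ⟨i, j, hij⟩ := h0
    -- Rows `i` and `j` of `P` span the plane; dividing one by `P i j` fixes the scale.
    refine ⟨P i, fun l => P j l / P i j, fun k l => ?_⟩
    have := h i j k l
    field_simp
    linear_combination this

/-- The coordinate ring of the cone over the Grassmannian of planes. -/
abbrev plueckerRing (ι : Type*) : Type _ := MvPolynomial (ι × ι) ℂ ⧸ plueckerIdeal ι

/-- The map on the coordinate ring of the cone induced by a pair of vectors. -/
def minorsLift (a b : ι → B) : plueckerRing ι →+* B :=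
  Ideal.Quotient.lift (plueckerIdeal ι) (minorsHom a b).toRingHom
    fun _ hx => plueckerIdeal_le_ker_minorsHom a b hx

@[simp]
theorem minorsLift_mk (a b : ι → B) (p : MvPolynomial (ι × ι) ℂ) :
    minorsLift a b (Ideal.Quotient.mk _ p) = minorsHom a b p := rfl

theorem minorsLift_comp {C : Type*} [CommRing C] [Algebra ℂ C] (κ : B →ₐ[ℂ] C) (a b : ι → B)
    (x : plueckerRing ι) : minorsLift (κ ∘ a) (κ ∘ b) x = κ (minorsLift a b x) := by
  obtain ⟨p, rfl⟩ := Ideal.Quotient.mk_surjective x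
  have : minorsHom (κ ∘ a) (κ ∘ b) = κ.comp (minorsHom a b) := by
    ext ⟨i, j⟩; simp
  rw [minorsLift_mk, minorsLift_mk, this]; rfl

/-- The `(i, j)` coordinate separates the kernels: it survives before `κ` and dies after it. -/
theorem ker_minorsLift_lt {C : Type*} [CommRing C] [Algebra ℂ C] (κ : B →ₐ[ℂ] C)
    (a b : ι → B) (i j : ι) (h : a i * b j - a j * b i ≠ 0) (h' : κ (a i * b j - a j * b i) = 0) :
    RingHom.ker (minorsLift a b) < RingHom.ker (minorsLift (κ ∘ a) (κ ∘ b)) := by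
  refine lt_of_le_of_ne (fun x hx => ?_) fun heq => h ?_
  · rw [RingHom.mem_ker] at hx ⊢
    rw [minorsLift_comp, hx, map_zero]
  · have : Ideal.Quotient.mk (plueckerIdeal ι) (X (i, j)) ∈ RingHom.ker (minorsLift a b) := by
      rw [heq, RingHom.mem_ker, minorsLift_comp]
      simpa using h'
    simpa using this

/-! ### A chain of primes ending at the vertex -/

section Chain

variable {m : ℕ}

/-- The polynomial ring of a chart of the cone. -/
abbrev chartRing (m : ℕ) : Type := MvPolynomial (Option (Fin m ⊕ Fin m)) ℂ

/-- The specialization of the chart which sends the coordinates in `U` to zero. -/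
def killVars (U : Finset (Fin m ⊕ Fin m)) : chartRing m →ₐ[ℂ] chartRing m :=
  aeval fun w => w.elim (X none) fun v => if v ∈ U then 0 else X (some v)

@[simp]
theorem killVars_X_none (U : Finset (Fin m ⊕ Fin m)) :
    killVars U (X none) = X none := by
  simp [killVars]

@[simp]
theorem killVars_X_some (U : Finset (Fin m ⊕ Fin m)) (v : Fin m ⊕ Fin m) :
    killVars U (X (some v)) = if v ∈ U then 0 else X (some v) := by
  simp [killVars]

/-- The first vector of the chart. -/
def chartFst (m : ℕ) : Fin (m + 2) → chartRing m :=
  Fin.cons (X none) (Fin.cons 0 fun j => X (some (Sum.inl j)))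

/-- The second vector of the chart. -/
def chartSnd (m : ℕ) : Fin (m + 2) → chartRing m :=
  Fin.cons 0 (Fin.cons 1 fun j => X (some (Sum.inr j)))

@[simp]
theorem chartFst_zero : chartFst m 0 = X none := rfl

@[simp]
theorem chartFst_one : chartFst m 1 = 0 := rfl

@[simp]
theorem chartFst_succ_succ (j : Fin m) : chartFst m j.succ.succ = X (some (Sum.inl j)) := rfl

@[simp]
theorem chartSnd_zero : chartSnd m 0 = 0 := rfl

@[simp]
theorem chartSnd_one : chartSnd m 1 = 1 := rfl

@[simp]
theorem chartSnd_succ_succ (j : Fin m) : chartSnd m j.succ.succ = X (some (Sum.inr j)) := rfl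

theorem killVars_comp_singleton (v : Fin m ⊕ Fin m) (U : Finset (Fin m ⊕ Fin m)) :
    (killVars {v}).comp (killVars U) = killVars (insert v U) := by
  ext1 w
  cases w with
  | none => simp
  | some w => 
    by_cases h' : w = v
    · subst h'; by_cases h : w ∈ U <;> simp [h]
    · by_cases h : w ∈ U <;> simp [h, h']

/-- The prime of the cone which is the kernel of a specialized chart. -/
def chartPrime (U : Finset (Fin m ⊕ Fin m)) : Ideal (plueckerRing (Fin (m + 2))) :=
  RingHom.ker (minorsLift (killVars U ∘ chartFst m) (killVars U ∘ chartSnd m))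

instance (U : Finset (Fin m ⊕ Fin m)) : (chartPrime U).IsPrime := RingHom.ker_isPrime _

theorem chartPrime_lt_insert {v : Fin m ⊕ Fin m} {U : Finset (Fin m ⊕ Fin m)} (hv : v ∉ U) :
    chartPrime U < chartPrime (insert v U) := by
  have key := ker_minorsLift_lt (killVars {v}) (killVars U ∘ chartFst m) (killVars U ∘ chartSnd m)
  have hcomp : ∀ f : Fin (m + 2) → chartRing m,
      killVars {v} ∘ killVars U ∘ f = killVars (insert v U) ∘ f := fun f => by
    rw [← killVars_comp_singleton]; rfl
  rw [hcomp, hcomp] at key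
  cases v with
  -- With rows (T, 0, x) and (0, 1, y), the minor at `(1, j + 2)` is -xⱼ and the one at `(0, j + 2)`
  -- is T yⱼ. The latter needs T to be alive, so T is killed last.
  | inl j => exact key 1 j.succ.succ (by simp [hv]) (by simp [hv])
  | inr j => exact key 0 j.succ.succ (by simp [hv]) (by simp [hv])

theorem card_le_height_chartPrime (U : Finset (Fin m ⊕ Fin m)) :
    (U.card : ℕ∞) ≤ (chartPrime U).height := by
  induction U using Finset.induction_on with
  | empty => simp
  | insert v U hv ih =>
    rw [Finset.card_insert_of_notMem hv, Nat.cast_add, Nat.cast_one]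
    exact (add_le_add_left ih 1).trans
      (Ideal.height_add_one_le_of_lt_of_isPrime (chartPrime_lt_insert hv))

/-- The ideal of the vertex of the cone. -/
def vertexIdeal (ι : Type*) : Ideal (plueckerRing ι) :=
  RingHom.ker (minorsLift (0 : ι → ℂ) (0 : ι → ℂ))

instance (ι : Type*) : (vertexIdeal ι).IsPrime := RingHom.ker_isPrime _

theorem le_height_vertexIdeal (m : ℕ) :
    ((2 * m + 1 : ℕ) : ℕ∞) ≤ (vertexIdeal (Fin (m + 2))).height := by
  have h := card_le_height_chartPrime (Finset.univ : Finset (Fin m ⊕ Fin m))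
  have hlt : chartPrime (Finset.univ : Finset (Fin m ⊕ Fin m)) < vertexIdeal (Fin (m + 2)) := by
    -- After the 2m coordinates x, y, killing T, the minor at `(0, 1)`, gives one more strict step.
    have key := ker_minorsLift_lt (aeval 0 : chartRing m →ₐ[ℂ] ℂ)
      (killVars Finset.univ ∘ chartFst m) (killVars Finset.univ ∘ chartSnd m) 0 1
      (by simp) (by simp)
    refine key.trans_eq ?_
    rw [vertexIdeal]
    congr 1
    refine Ideal.Quotient.ringHom_ext (RingHom.ext fun p => ?_)
    refine DFunLike.congr_fun (f := minorsHom _ _) (g := minorsHom _ _) (algHom_ext fun p => ?_) p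
    have h0 : ∀ i, aeval (0 : Option (Fin m ⊕ Fin m) → ℂ)
        (killVars Finset.univ (chartFst m i)) = 0 :=
      Fin.cases (by simp) (Fin.cases (by simp) fun j => by simp)
    simp only [minorsHom, aeval_X, Function.comp_apply, h0]
    simp
  have h2 := Ideal.height_add_one_le_of_lt_of_isPrime hlt
  refine le_trans ?_ h2
  rw [Nat.cast_add, Nat.cast_one]
  refine add_le_add_left (le_trans (le_of_eq ?_) h) 1
  simp [two_mul]

end Chain

/-- The linear section of the cone given by a family of matrices. -/
def linearForm [Fintype ι] (c : ι → ι → ℂ) : MvPolynomial (ι × ι) ℂ :=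
  ∑ i, ∑ j, C (c i j) * X (i, j)

/-- By the Nullstellensatz: a prime containing the linear forms has no zero other than the zero
matrix, so it contains every coordinate and hence the vertex ideal. -/
theorem vertexIdeal_mem_minimalPrimes {ι : Type*} [Fintype ι] {e : ℕ} (c : Fin e → ι → ι → ℂ)
    (h : ∀ a b : ι → ℂ, (∀ k, ∑ i, ∑ j, c k i j * (a i * b j - a j * b i) = 0) →
      ∀ i j, a i * b j - a j * b i = 0) :
    vertexIdeal ι ∈ (Ideal.span (Set.range fun k =>
      Ideal.Quotient.mk (plueckerIdeal ι) (linearForm (c k)))).minimalPrimes := by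
  refine ⟨⟨inferInstance, ?_⟩, ?_⟩
  · rw [Ideal.span_le]
    rintro _ ⟨k, rfl⟩
    simp [vertexIdeal, linearForm]
  · rintro P ⟨hP, hle⟩ -
    have := hP
    set P' : Ideal (MvPolynomial (ι × ι) ℂ) := P.comap (Ideal.Quotient.mk _) with hP'
    have hX : ∀ i j, X (i, j) ∈ P' := by
      intro i j
      rw [← IsPrime.vanishingIdeal_zeroLocus (K := ℂ) P', mem_vanishingIdeal_iff]
      intro x hx
      rw [mem_zeroLocus_iff] at hx
      obtain ⟨a, b, hab⟩ := exists_minors_of_pluecker (P := fun i j => x (i, j)) fun i j k l => by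
        have hmem : X (i, j) * X (k, l) - (X (i, k) * X (j, l) - X (i, l) * X (j, k)) ∈ P' := by
          rw [hP', Ideal.mem_comap, Ideal.Quotient.eq_zero_iff_mem.2]
          · exact zero_mem _
          · exact Ideal.subset_span ⟨((i, j), (k, l)), rfl⟩
        simpa [sub_eq_zero] using hx _ hmem
      have hz := h a b fun k => by
        have := hx (linearForm (c k)) (hle (Ideal.subset_span ⟨k, rfl⟩))
        simp only [linearForm, map_sum, map_mul, aeval_X, aeval_C] at this
        simpa [hab] using this
      rw [aeval_X, hab, hz]
    intro y hy
    obtain ⟨p, rfl⟩ := Ideal.Quotient.mk_surjective y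
    have hmk : Ideal.Quotient.mkₐ ℂ P' = (Algebra.ofId ℂ _).comp (minorsHom 0 0) :=
      algHom_ext fun p => by
        rw [AlgHom.comp_apply, minorsHom_X]
        simpa using Ideal.Quotient.eq_zero_iff_mem.2 (hX p.1 p.2)
    have h0 : minorsHom (0 : ι → ℂ) (0 : ι → ℂ) p = 0 := hy
    have hp := DFunLike.congr_fun hmk p
    rw [AlgHom.comp_apply, h0, map_zero] at hp
    exact (Ideal.Quotient.eq_zero_iff_mem (I := P')).1 hp

theorem two_mul_add_one_le_of_nonsingular {m e : ℕ} (c : Fin e → Fin (m + 2) → Fin (m + 2) → ℂ)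
    (h : ∀ a b : Fin (m + 2) → ℂ,
      (∀ k, ∑ i, ∑ j, c k i j * (a i * b j - a j * b i) = 0) →
        ∀ i j, a i * b j - a j * b i = 0) :
    2 * m + 1 ≤ e := by
  have h1 := Ideal.height_le_card_of_mem_minimalPrimes_span (Set.finite_range _)
    (vertexIdeal_mem_minimalPrimes c h)
  refine (Nat.cast_le.1 ((le_height_vertexIdeal m).trans h1)).trans ?_
  rw [← Set.image_univ]
  exact (Set.ncard_image_le Set.finite_univ).trans (by simp)

end Pluecker

/-! ### Primitives of 2-cocycles on free groups -/

section CentralExtension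

variable {G : Type} [Group G]

theorem cocycle_apply (c : groupCohomology.cocycles₂ (triv G)) (g h j : G) :
    (c (g * h, j) + c (g, h) : ℂ) = c (h, j) + c (g, h * j) := by
  simpa using (groupCohomology.mem_cocycles₂_iff (A := triv G) _).1 c.2 g h j

theorem cocycle_one_left (c : groupCohomology.cocycles₂ (triv G)) (g : G) :
    (c (1, g) : ℂ) = c (1, 1) :=
  groupCohomology.cocycles₂_map_one_fst c g

theorem cocycle_one_right (c : groupCohomology.cocycles₂ (triv G)) (g : G) :
    (c (g, 1) : ℂ) = c (1, 1) := by
  simpa using groupCohomology.cocycles₂_map_one_snd c g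

/-- The central extension of `G` by `ℂ` given by a `2`-cocycle. -/
structure CentralExt (c : groupCohomology.cocycles₂ (triv G)) where
  fst : ℂ
  snd : G

namespace CentralExt

variable {c : groupCohomology.cocycles₂ (triv G)}

@[ext]
theorem ext' {x y : CentralExt c} (h : x.fst = y.fst) (h' : x.snd = y.snd) : x = y := by
  cases x; cases y; simp_all

instance : Mul (CentralExt c) := ⟨fun x y => ⟨x.fst + y.fst + c (x.snd, y.snd), x.snd * y.snd⟩⟩
-- The cocycle is not assumed normalized, hence the correction by c(1, 1).
instance : One (CentralExt c) := ⟨⟨-(c (1, 1) : ℂ), 1⟩⟩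
instance : Inv (CentralExt c) :=
  ⟨fun x => ⟨-x.fst - (c (x.snd⁻¹, x.snd) : ℂ) - (c (1, 1) : ℂ), x.snd⁻¹⟩⟩

theorem fst_mul (x y : CentralExt c) : (x * y).fst = x.fst + y.fst + c (x.snd, y.snd) := rfl
theorem snd_mul (x y : CentralExt c) : (x * y).snd = x.snd * y.snd := rfl
theorem fst_one : (1 : CentralExt c).fst = -(c (1, 1) : ℂ) := rfl
theorem snd_one : (1 : CentralExt c).snd = 1 := rfl
theorem fst_inv (x : CentralExt c) :
    (x⁻¹).fst = -x.fst - (c (x.snd⁻¹, x.snd) : ℂ) - (c (1, 1) : ℂ) := rfl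
theorem snd_inv (x : CentralExt c) : (x⁻¹).snd = x.snd⁻¹ := rfl

instance : Group (CentralExt c) :=
  Group.ofLeftAxioms
    (fun x y z => ext'
      (by
        have := cocycle_apply c x.snd y.snd z.snd
        simp only [fst_mul, snd_mul]
        linear_combination this)
      (mul_assoc _ _ _))
    (fun x => ext'
      (by
        have := cocycle_one_left c x.snd
        simp only [fst_mul, fst_one, snd_one]
        linear_combination this)
      (one_mul _))
    (fun x => ext'
      (by
        simp only [fst_mul, fst_one, fst_inv, snd_inv]
        ring)
      (inv_mul_cancel _))

end CentralExt

/-- A `2`-cocycle becomes a coboundary on a free group. -/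
theorem exists_coboundary_of_freeGroup {α : Type*} (π : FreeGroup α →* G)
    (c : groupCohomology.cocycles₂ (triv G)) :
    ∃ f : FreeGroup α → ℂ, ∀ x y, f (x * y) = f x + f y - c (π x, π y) := by
  -- Freeness lifts `π` to the extension; minus the ℂ-coordinate of the lift is the primitive.
  let s : FreeGroup α →* CentralExt c := FreeGroup.lift fun i => ⟨0, π (FreeGroup.of i)⟩
  let p : CentralExt c →* G := ⟨⟨CentralExt.snd, rfl⟩, fun _ _ => rfl⟩
  have hs : p.comp s = π := FreeGroup.ext_hom _ _ fun i => by simp [s, p]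
  have hs' : ∀ x, (s x).snd = π x := fun x => DFunLike.congr_fun hs x
  refine ⟨fun x => -(s x).fst, fun x y => ?_⟩
  simp only [map_mul, CentralExt.fst_mul, hs']
  ring

variable {F : Type*} [Group F] {π : F →* G} {c : groupCohomology.cocycles₂ (triv G)} {f : F → ℂ}

/-- The elements of the kernel on which a primitive of a `2`-cocycle vanishes. -/
def primitiveKernel (hf : ∀ x y, f (x * y) = f x + f y - c (π x, π y)) : Subgroup F where
  carrier := {x | π x = 1 ∧ f x = f 1}
  one_mem' := ⟨map_one _, rfl⟩
  mul_mem' := by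
    rintro x y ⟨hx, hx'⟩ ⟨hy, hy'⟩
    have h1 := hf 1 1
    refine ⟨by simp [hx, hy], ?_⟩
    rw [hf, hx, hy, hx', hy']
    rw [mul_one, map_one] at h1
    linear_combination -h1
  inv_mem' := by
    rintro x ⟨hx, hx'⟩
    have h1 := hf 1 1
    have h2 := hf x x⁻¹
    refine ⟨by simp [hx], ?_⟩
    rw [mul_one, map_one] at h1
    rw [mul_inv_cancel, map_inv, hx, inv_one, hx'] at h2
    linear_combination h1 - h2

theorem primitive_mul_of_mem (hf : ∀ x y, f (x * y) = f x + f y - c (π x, π y)) (y : F) {x : F}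
    (hx : x ∈ primitiveKernel hf) : f (y * x) = f y := by
  obtain ⟨hx, hx'⟩ := hx
  have h1 := hf 1 1
  have h2 := cocycle_one_right c (π y)
  rw [mul_one, map_one] at h1
  rw [hf, hx, hx']
  linear_combination -h1 - h2

instance primitiveKernel_normal (hf : ∀ x y, f (x * y) = f x + f y - c (π x, π y)) :
    (primitiveKernel hf).Normal where
  conj_mem x hx y := by
    refine ⟨by simp [hx.1], ?_⟩
    have h1 := hf y y⁻¹
    rw [hf, primitive_mul_of_mem hf y hx, map_mul, hx.1, mul_one, ← h1, mul_inv_cancel]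

/-- `primitiveKernel` is normal, so once it contains the relators it contains all of `π.ker`. The
primitive is then constant on the fibres of `π` and descends to G. -/
theorem mem_coboundaries_of_primitive (hf : ∀ x y, f (x * y) = f x + f y - c (π x, π y))
    (hπ : Function.Surjective π) {s : Set F} (hker : π.ker = Subgroup.normalClosure s)
    (hs : ∀ r ∈ s, f r = f 1) : ⇑c ∈ groupCohomology.coboundaries₂ (triv G) := by
  have hle : π.ker ≤ primitiveKernel hf := by
    rw [hker]
    refine Subgroup.normalClosure_le_normal fun r hr => ⟨?_, hs r hr⟩
    rw [← MonoidHom.mem_ker, hker]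
    exact Subgroup.subset_normalClosure hr
  have hfac : ∀ x y, π x = π y → f x = f y := fun x y hxy => by
    rw [← primitive_mul_of_mem hf y (hle (show y⁻¹ * x ∈ π.ker by simp [MonoidHom.mem_ker, hxy])),
      mul_inv_cancel_left]
  refine ⟨fun g => f (Function.surjInv hπ g), ?_⟩
  ext p
  obtain ⟨g, h⟩ := p
  obtain ⟨x, rfl⟩ := hπ g
  obtain ⟨y, rfl⟩ := hπ h
  have h' : ∀ x, f (Function.surjInv hπ (π x)) = f x := fun x =>
    hfac _ _ (Function.surjInv_eq hπ _)
  change f (Function.surjInv hπ (π y)) - f (Function.surjInv hπ (π x * π y))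
    + f (Function.surjInv hπ (π x)) = c (π x, π y)
  rw [← map_mul, h', h', h', hf]
  ring

end CentralExtension

/-! ### The bound on H² from a presentation -/

section Dimension

/-- Only `N` is assumed finite-dimensional, since `M` will be the space of all 2-cocycles. -/
theorem finrank_le_of_ker_le {K M N N' : Type*} [Field K] [AddCommGroup M] [Module K M]
    [AddCommGroup N] [Module K N] [AddCommGroup N'] [Module K N'] [Module.Finite K N]
    (f : M →ₗ[K] N) (g : M →ₗ[K] N') (hg : Function.Surjective g)
    (h : LinearMap.ker f ≤ LinearMap.ker g) :
    Module.Finite K N' ∧ Module.finrank K N' ≤ Module.finrank K N := by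
  let φ : LinearMap.range f →ₗ[K] N' :=
    (LinearMap.ker f).liftQ g h ∘ₗ f.quotKerEquivRange.symm.toLinearMap
  have hφ : Function.Surjective φ := by
    have h' : Function.Surjective ((LinearMap.ker f).liftQ g h) := fun y => by
      obtain ⟨x, rfl⟩ := hg y
      exact ⟨Submodule.Quotient.mk x, rfl⟩
    exact h'.comp f.quotKerEquivRange.symm.surjective
  exact ⟨Module.Finite.of_surjective φ hφ,
    (LinearMap.finrank_le_finrank_of_surjective hφ).trans (Submodule.finrank_le _)⟩

/-- Evaluation of homomorphisms at a family of group elements. -/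
def evalAt {F : Type*} [Group F] {q : ℕ} (r : Fin q → F) :
    (Additive F →+ ℂ) →ₗ[ℂ] (Fin q → ℂ) where
  toFun a i := a (Additive.ofMul (r i))
  map_add' _ _ := rfl
  map_smul' _ _ := rfl

variable {G : Type} [Group G]

/-- The pairs of a `2`-cocycle and a primitive of its pull-back. -/
def primitives {F : Type*} [Group F] (π : F →* G) :
    Submodule ℂ (groupCohomology.cocycles₂ (triv G) × (F → ℂ)) where
  carrier := {p | ∀ x y, p.2 (x * y) = p.2 x + p.2 y - p.1 (π x, π y)}
  zero_mem' x y := by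
    change (0 : ℂ) = 0 + 0 - 0
    simp
  add_mem' {p p'} h h' x y := by
    change p.2 (x * y) + p'.2 (x * y) = p.2 x + p'.2 x + (p.2 y + p'.2 y)
      - (p.1 (π x, π y) + p'.1 (π x, π y))
    rw [h, h']; ring
  smul_mem' t p h x y := by
    change t * p.2 (x * y) = t * p.2 x + t * p.2 y - t * p.1 (π x, π y)
    rw [h]; ring

theorem finrank_CH2_le {α : Type*} (π : FreeGroup α →* G) (hπ : Function.Surjective π) {q : ℕ}
    (r : Fin q → FreeGroup α) (hker : π.ker = Subgroup.normalClosure (Set.range r)) :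
    Module.Finite ℂ (CH2 G) ∧
      Module.finrank ℂ (CH2 G) + Module.finrank ℂ (LinearMap.range (evalAt r)) ≤ q := by
  let P := primitives π
  let p₁ : P →ₗ[ℂ] groupCohomology.cocycles₂ (triv G) := LinearMap.fst ℂ _ _ ∘ₗ P.subtype
  have hp₁ : Function.Surjective p₁ := fun c => by
    obtain ⟨f, hf⟩ := exists_coboundary_of_freeGroup π c
    exact ⟨⟨(c, f), hf⟩, rfl⟩
  obtain ⟨s, hs⟩ := p₁.exists_rightInverse_of_surjective (LinearMap.range_eq_top.2 hp₁)
  -- Subtracting `f 1` is needed because a primitive takes the value c(1, 1) at the identity.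
  let ev : (FreeGroup α → ℂ) →ₗ[ℂ] (Fin q → ℂ) :=
    { toFun := fun f i => f (r i) - f 1
      map_add' := fun f g => by ext i; simp; ring
      map_smul' := fun t f => by ext i; simp; ring }
  let τ : groupCohomology.cocycles₂ (triv G) →ₗ[ℂ] (Fin q → ℂ) ⧸ LinearMap.range (evalAt r) :=
    (LinearMap.range (evalAt r)).mkQ ∘ₗ ev ∘ₗ LinearMap.snd ℂ _ _ ∘ₗ P.subtype ∘ₗ s
  have hτ : LinearMap.ker τ ≤ LinearMap.ker (groupCohomology.H2π (triv G)).hom := by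
    intro c hc
    have hc' : ev (s c).1.2 ∈ LinearMap.range (evalAt r) := by
      rw [LinearMap.mem_ker] at hc
      exact (Submodule.Quotient.mk_eq_zero _).1 hc
    obtain ⟨a, ha⟩ := hc'
    have h1 : (s c).1.1 = c := DFunLike.congr_fun hs c
    have hf := (s c).2
    change ∀ x y, (s c).1.2 (x * y) = (s c).1.2 x + (s c).1.2 y - (s c).1.1 (π x, π y) at hf
    rw [h1] at hf
    refine (groupCohomology.H2π_eq_zero_iff c).2 ?_
    -- Subtracting the homomorphism `a` gives another primitive of `c`, now constant on the relators
    -- and 1.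
    refine mem_coboundaries_of_primitive (f := fun x => (s c).1.2 x - a (Additive.ofMul x))
      (fun x y => ?_) hπ hker ?_
    · simp only [hf, ofMul_mul, map_add]; ring
    · rintro _ ⟨i, rfl⟩
      have := congrFun ha i
      change a (Additive.ofMul (r i)) = (s c).1.2 (r i) - (s c).1.2 1 at this
      simp only [this, ofMul_one, map_zero]
      ring
  obtain ⟨h1, h2⟩ := finrank_le_of_ker_le τ (groupCohomology.H2π (triv G)).hom
    ((ModuleCat.epi_iff_surjective _).1 inferInstance) hτ
  refine ⟨h1, ?_⟩
  have h3 := Submodule.finrank_quotient_add_finrank (LinearMap.range (evalAt r))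
  rw [Module.finrank_fin_fun] at h3
  change Module.finrank ℂ (CH2 G) ≤ _ at h2
  omega

theorem smul_homologyClass (z : ℂ) (g : G) :
    z • homologyClass g = (groupHomology.H1AddEquivOfIsTrivial (triv G)).symm
      (Additive.ofMul (Abelianization.of g) ⊗ₜ[ℤ] z) := by
  rw [groupHomology.H1AddEquivOfIsTrivial_symm_tmul, homologyClass,
    groupHomology.mkH1OfIsTrivial_apply]
  let L : ℂ →ₗ[ℂ] HH1 G := (groupHomology.H1π (triv G)).hom ∘ₗ
    (groupHomology.cycles₁IsoOfIsTrivial (triv G)).inv.hom ∘ₗ Finsupp.lsingle g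
  change z • L 1 = L z
  rw [← map_smul, smul_eq_mul, mul_one]

theorem H1_induction {p : HH1 G → Prop} (h0 : p 0) (hadd : ∀ x y, p x → p y → p (x + y))
    (h : ∀ (g : G) (z : ℂ), p (z • homologyClass g)) (y : HH1 G) : p y := by
  obtain ⟨T, rfl⟩ := (groupHomology.H1AddEquivOfIsTrivial (triv G)).symm.surjective y
  induction T using TensorProduct.induction_on with
  | zero => rwa [map_zero]
  | add x y hx hy => rw [map_add]; exact hadd _ _ hx hy
  | tmul x z =>
    obtain ⟨g, hg⟩ := QuotientGroup.mk_surjective x.toMul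
    obtain rfl : Additive.ofMul (Abelianization.of g) = x := hg
    rw [← smul_homologyClass]
    exact h g z

/-- The additive functional on `H_1(G, ℂ)` induced by a homomorphism on `G`. -/
def homToDualAux (a : Additive G →+ ℂ) : HH1 G →+ ℂ :=
  (TensorProduct.liftAddHom
    (AddMonoidHom.mul.comp (AddMonoidHom.toMultiplicativeRight.symm
      (Abelianization.lift (AddMonoidHom.toMultiplicativeRight a))) :
        Additive (Abelianization G) →+ ℂ →+ ℂ)
    (fun t x z => by simp; ring)).comp
    (groupHomology.H1AddEquivOfIsTrivial (triv G)).toAddMonoidHom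

theorem homToDualAux_smul_homologyClass (a : Additive G →+ ℂ) (z : ℂ) (g : G) :
    homToDualAux a (z • homologyClass g) = a (Additive.ofMul g) * z := by
  rw [smul_homologyClass, homToDualAux]
  simp

/-- Classes of group elements span H₁, which gives injectivity. Surjectivity uses H₁ = Gᵃᵇ ⊗ ℂ; that
identification is only additive, so ℂ-linearity is checked on multiples of classes. -/
theorem dualToHom_bijective : Function.Bijective (dualToHom (G := G)) := by
  constructor
  · refine (injective_iff_map_eq_zero _).2 fun φ hφ => LinearMap.ext fun y => ?_
    induction y using H1_induction with
    | h0 => simp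
    | hadd x y hx hy => simpa [hx] using hy
    | h g z =>
      have : φ (homologyClass g) = 0 := DFunLike.congr_fun hφ (Additive.ofMul g)
      simp [this]
  · intro a
    refine ⟨{ homToDualAux a with map_smul' := fun t y => ?_ }, ?_⟩
    · change homToDualAux a (t • y) = t * homToDualAux a y
      induction y using H1_induction with
      | h0 => simp
      | hadd x y hx hy => rw [smul_add, map_add, map_add, hx, hy, mul_add]
      | h g z =>
        rw [smul_smul, homToDualAux_smul_homologyClass, homToDualAux_smul_homologyClass]
        ring
    · ext g
      change homToDualAux a (homologyClass g) = a (Additive.ofMul g)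
      rw [← one_smul ℂ (homologyClass g), homToDualAux_smul_homologyClass, mul_one]

/-- Restriction of homomorphisms along a group homomorphism. -/
def restrictHom {F : Type*} [Group F] (π : F →* G) :
    (Additive G →+ ℂ) →ₗ[ℂ] (Additive F →+ ℂ) where
  toFun a := a.comp π.toAdditive
  map_add' _ _ := rfl
  map_smul' _ _ := rfl

theorem ker_evalAt_le {F : Type*} [Group F] (π : F →* G) (hπ : Function.Surjective π) {q : ℕ}
    (r : Fin q → F) (hker : π.ker = Subgroup.normalClosure (Set.range r)) :
    LinearMap.ker (evalAt r) ≤ LinearMap.range (restrictHom π) := by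
  intro a ha
  have hle : π.ker ≤ (AddMonoidHom.toMultiplicativeRight a).ker := by
    rw [hker]
    refine Subgroup.normalClosure_le_normal ?_
    rintro _ ⟨i, rfl⟩
    exact congrFun (LinearMap.mem_ker.1 ha) i
  refine ⟨AddMonoidHom.toMultiplicativeRight.symm
    (π.liftOfSurjective hπ ⟨AddMonoidHom.toMultiplicativeRight a, hle⟩), ?_⟩
  refine AddMonoidHom.ext fun x => ?_
  exact MonoidHom.liftOfRightInverse_comp_apply π _ (Function.rightInverse_surjInv hπ)
    ⟨AddMonoidHom.toMultiplicativeRight a, hle⟩ x.toMul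

/-- A homomorphism on a free group is determined by its values on the generators. -/
def freeHomEquiv (m : ℕ) : (Additive (FreeGroup (Fin m)) →+ ℂ) ≃ₗ[ℂ] (Fin m → ℂ) where
  toFun a i := a (Additive.ofMul (FreeGroup.of i))
  map_add' _ _ := rfl
  map_smul' _ _ := rfl
  invFun v := AddMonoidHom.toMultiplicativeRight.symm
    (FreeGroup.lift fun i => Multiplicative.ofAdd (v i))
  left_inv a := AddMonoidHom.toMultiplicativeRight.injective
    (FreeGroup.ext_hom _ _ fun i => by simp)
  right_inv v := by ext i; simp

/-- The Euler characteristic bound for the second cohomology of a finitely presented group. -/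
theorem finrank_CH2_add_le {m q : ℕ} (h : HasPresentation G m q) :
    Module.Finite ℂ (HH1 G) ∧ Module.Finite ℂ (CH2 G) ∧
      Module.finrank ℂ (CH2 G) + m ≤ q + b₁ G := by
  obtain ⟨r, ⟨e⟩⟩ := h
  let π : FreeGroup (Fin m) →* G := e.toMonoidHom.comp (PresentedGroup.mk (Set.range r))
  have hπ : Function.Surjective π := e.surjective.comp (PresentedGroup.mk_surjective _)
  have hker : π.ker = Subgroup.normalClosure (Set.range r) := by
    ext x
    rw [← PresentedGroup.mk_eq_one_iff, MonoidHom.mem_ker]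
    exact e.map_eq_one_iff
  have hres : Function.Injective (restrictHom π) := fun a b hab => by
    refine AddMonoidHom.ext fun g => ?_
    obtain ⟨x, hx⟩ := hπ g.toMul
    have := DFunLike.congr_fun hab (Additive.ofMul x)
    change a (Additive.ofMul (π x)) = b (Additive.ofMul (π x)) at this
    rwa [hx] at this
  have : Module.Finite ℂ (Additive (FreeGroup (Fin m)) →+ ℂ) :=
    Module.Finite.equiv (freeHomEquiv m).symm
  have : Module.Finite ℂ (Additive G →+ ℂ) := Module.Finite.of_injective _ hres
  let d : Module.Dual ℂ (HH1 G) ≃ₗ[ℂ] (Additive G →+ ℂ) :=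
    LinearEquiv.ofBijective _ dualToHom_bijective
  have : Module.Finite ℂ (Module.Dual ℂ (HH1 G)) := Module.Finite.equiv d.symm
  have hV : Module.Finite ℂ (HH1 G) := Module.finite_dual_iff ℂ |>.1 this
  obtain ⟨h1, h2⟩ := finrank_CH2_le π hπ r hker
  refine ⟨hV, h1, ?_⟩
  -- Rank-nullity on Hom(F, ℂ), of dimension m, where the kernel has dimension at most b₁.
  have h3 := (evalAt r).finrank_range_add_finrank_ker
  have h4 := Submodule.finrank_mono (ker_evalAt_le π hπ r hker)
  rw [LinearMap.finrank_range_of_inj hres, ← d.finrank_eq, Subspace.dual_finrank_eq] at h4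
  rw [(freeHomEquiv m).finrank_eq, Module.finrank_fin_fun] at h3
  rw [b₁]
  omega

end Dimension

/-! ### Decomposable elements in the kernel of a linear map on ⋀² -/

section Rank

variable {W E : Type*} [AddCommGroup W] [Module ℂ W] [AddCommGroup E] [Module ℂ E]

theorem minors_eq_zero_of_wedge_eq_zero {x y : W} (h : wedge x y = 0) (f g : Module.Dual ℂ W) :
    f x * g y - g x * f y = 0 := by
  have := congrArg (exteriorPower.pairingDual ℂ W 2 (wedge f g)) h
  rw [wedge, wedge, exteriorPower.pairingDual_ιMulti_ιMulti] at this
  simpa [Matrix.det_fin_two] using this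

theorem wedge_swap (x y : W) : wedge y x = -wedge x y := by
  have := (exteriorPower.ιMulti ℂ 2 (M := W)).map_swap ![x, y] (show (0 : Fin 2) ≠ 1 by decide)
  rw [wedge, wedge, ← this]
  congr 1
  ext i
  fin_cases i <;> rfl

/-- The wedge product as a bilinear map. -/
def wedgeBilin (W : Type*) [AddCommGroup W] [Module ℂ W] : W →ₗ[ℂ] W →ₗ[ℂ] ⋀[ℂ]^2 W :=
  LinearMap.mk₂ ℂ wedge
    (fun x x' y => (exteriorPower.ιMulti ℂ 2).map_vecCons_add ![y] x x')
    (fun t x y => (exteriorPower.ιMulti ℂ 2).map_vecCons_smul ![y] t x)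
    (fun x y y' => by
      rw [wedge_swap _ x, wedge_swap y x, wedge_swap y' x, ← neg_add]
      exact congrArg _ ((exteriorPower.ιMulti ℂ 2).map_vecCons_add ![x] y y'))
    (fun t x y => by
      rw [wedge_swap _ x, wedge_swap y x, smul_neg]
      exact congrArg _ ((exteriorPower.ιMulti ℂ 2).map_vecCons_smul ![x] t y))

theorem apply_sub_apply_eq_sum {m : ℕ} (β : W →ₗ[ℂ] W →ₗ[ℂ] E) (w : Fin m → W) (a b : Fin m → ℂ) :
    β (∑ i, a i • w i) (∑ j, b j • w j) - β (∑ j, b j • w j) (∑ i, a i • w i)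
      = ∑ i, ∑ j, (a i * b j - a j * b i) • β (w i) (w j) := by
  simp only [map_sum, map_smul, LinearMap.sum_apply, LinearMap.smul_apply, Finset.smul_sum,
    sub_smul, Finset.sum_sub_distrib, smul_smul]
  congr 1
  · rw [Finset.sum_comm]
    exact Finset.sum_congr rfl fun i _ => Finset.sum_congr rfl fun j _ => by rw [mul_comm]
  · exact Finset.sum_comm

/-- The kernel of a linear map on `⋀² W` contains a nonzero decomposable element unless
the dimension of the target is at least that of the Grassmannian cone. -/
theorem two_mul_finrank_le [Module.Finite ℂ W] [Module.Finite ℂ E] (φ : ⋀[ℂ]^2 W →ₗ[ℂ] E)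
    (h : ∀ x y : W, φ (wedge x y) = 0 → wedge x y = 0) :
    2 * Module.finrank ℂ W ≤ Module.finrank ℂ E + 3 := by
  obtain hn | ⟨m, hm⟩ : Module.finrank ℂ W ≤ 1 ∨ ∃ m, Module.finrank ℂ W = m + 2 := by
    by_cases hn : Module.finrank ℂ W ≤ 1
    · exact Or.inl hn
    · exact Or.inr ⟨_, (Nat.sub_add_cancel (not_le.1 hn)).symm⟩
  · omega
  let w := Module.finBasisOfFinrankEq ℂ W hm
  let v := Module.finBasis ℂ E
  have key := two_mul_add_one_le_of_nonsingular
    (fun k i j => v.repr (φ (wedge (w i) (w j))) k) fun a b hab i j => by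
      set x := ∑ i, a i • w i
      set y := ∑ j, b j • w j
      have hsum := apply_sub_apply_eq_sum ((wedgeBilin W).compr₂ φ) w a b
      have h0 : φ (wedge x y) = 0 := by
        -- The sum runs over ordered pairs, so each basis wedge is counted twice.
        have h2 : (2 : ℂ) • φ (wedge x y) =
            ∑ i, ∑ j, (a i * b j - a j * b i) • φ (wedge (w i) (w j)) := by
          refine Eq.trans ?_ hsum
          change _ = φ (wedge x y) - φ (wedge y x)
          rw [wedge_swap x y, map_neg, sub_neg_eq_add, two_smul]
        refine (smul_eq_zero_iff_right (two_ne_zero' ℂ)).1 (h2.trans ?_)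
        refine v.repr.injective (Finsupp.ext fun k => ?_)
        simpa [Finsupp.finsetSum_apply, mul_comm] using hab k
      have h1 := minors_eq_zero_of_wedge_eq_zero (h x y h0) (w.coord i) (w.coord j)
      simpa [x, y, Finsupp.single_apply] using h1
  omega

end Rank

/-- Only the formal inclusion of ker ∪_G in K^⊥ is needed: a nonzero x ∧ y in the kernel makes x
resonant, so x = 0, which is absurd. -/
theorem wedge_eq_zero_of_cupMap_eq_zero {G : Type} [Group G] (hR : groupResonance G = {0})
    (x y : Module.Dual ℂ (HH1 G)) (h : cupMap G (wedge x y) = 0) : wedge x y = 0 := by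
  by_contra hne
  have hx : x ∈ groupResonance G := by
    refine Or.inl ⟨y, hne, (Submodule.mem_dualAnnihilator _).2 fun z hz => ?_⟩
    exact (Submodule.mem_dualCoannihilator _).1 hz _ (Submodule.mem_map_of_mem h)
  rw [hR, Set.mem_singleton_iff] at hx
  subst hx
  exact hne ((wedgeBilin _).map_zero₂ y)

end VanishingResonance

end

theorem mainTheorem7 (G : Type) [Group G] [Group.IsFinitelyPresented G]
    (hR : VanishingResonance.groupResonance G = {0}) :
    VanishingResonance.deficiency G ≤ ((3 - (VanishingResonance.b₁ G : ℝ) : ℝ) : EReal) := by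
  refine iSup_le fun m => iSup_le fun q => iSup_le fun h => ?_
  obtain ⟨_, _, h1⟩ := VanishingResonance.finrank_CH2_add_le h
  have h2 := VanishingResonance.two_mul_finrank_le (VanishingResonance.cupMap G)
    (VanishingResonance.wedge_eq_zero_of_cupMap_eq_zero hR)
  rw [Subspace.dual_finrank_eq] at h2
  have h3 : m + VanishingResonance.b₁ G ≤ q + 3 := by
    rw [VanishingResonance.b₁] at h1 ⊢
    omega
  rw [EReal.coe_le_coe_iff]
  have : (m : ℝ) + VanishingResonance.b₁ G ≤ q + 3 := by exact_mod_cast h3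
  linarith
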